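/- Let $C$ be an algebraically closed field of characteristic zero. For a differential field $(K,\delta)$ and nonzero operators $L,Q\in K[D]$, a symmetric product $L\otimes Q$ is a nonzero operator in $K[D]$ of lowest order such that, in every commutative differential ring extending $(K,\delta)$, it annihilates $fg$ whenever $f$ is a solution of $L$ and $g$ is a solution of $Q$; it exists and is unique up to left multiplication by a nonzero element of $K$. For operators in $C(x)[D]$ it is taken over $K=C(x)$ with $\delta=d/dx$. For polynomials in $C[s]$ it is the symmetric product of linear differential operators with constant coefficients, i.e. a polynomial in $s$ is read as an operator in $C[D]$ (with $D=s$, $K=C$, $\delta=0$), and it is then unique up to a nonzero constant. For a nonzero operator $N=\sum_i \ell_i D^i$ whose coefficients are Laurent series at $0$ in a fractional power $x^{1/v}$ (rational functions being expanded at $0$), write $N\cdot x^s=x^{s+\sigma}\bigl(p_0(s)+\sum_{e>0,\ e\in\frac1v\mathbb Z}p_e(s)x^e\bigr)$ with $p_0,p_e\in C[s]$, $p_0\ne0$; then $p_0$ is the indicial polynomial $\operatorname{ind}_0(N)$ of $N$ at $0$. For $L\in C(x)[D]$ and $p\in C[x^{1/v}]$, the generalized indicial polynomial $\operatorname{ind}_{0,\exp(p(x^{-1}))}(L)$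 is $\operatorname{ind}_0$ of $\exp(-p(x^{-1}))\,L\,\exp(p(x^{-1}))$, i.e. of the operator obtained from $L$ by replacing $D$ with $D+(p(x^{-1}))'$. **Theorem.** Let $L,Q\in C(x)[D]$ be nonzero, let $v\ge1$ be an integer and let $p,q\in C[x^{1/v}]$. Then the symmetric product (in $C[s]$) $$\operatorname{ind}_{0,\exp(p(x^{-1}))}(L)\otimes\operatorname{ind}_{0,\exp(q(x^{-1}))}(Q)$$ divides $\operatorname{ind}_{0,\exp(p(x^{-1})+q(x^{-1}))}(L\otimes Q)$ in $C[s]$. In particular (for $p=q=0$), $\operatorname{ind}_0(L)\otimes\operatorname{ind}_0(Q)$ divides $\operatorname{ind}_0(L\otimes Q)$. -/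

import Mathlib

open Polynomial

universe u

namespace DiffOp

/-! ### Linear differential operators

A linear differential operator `ℓ₀ + ℓ₁ D + ⋯ + ℓᵣ Dʳ` over a field (or commutative ring) `K`
with a derivation is stored as its list of left coefficients, that is, as the polynomial
`ℓ₀ + ℓ₁ X + ⋯ + ℓᵣ Xʳ : K[X]`; its order is `natDegree`. The product of `K[X]` is the composition
of operators only for constant coefficients; in general, composition is used only in the form
`dMul` below. -/

/-- The derivations of a commutative ring `A`. -/
abbrev Der (A : Type*) [CommRing A] := Derivation ℤ A A

/-- The action `L · f = ∑ ℓᵢ f⁽ⁱ⁾` of an operator on an element of a differential `K`-algebra. -/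
noncomputable def apply {K F : Type*} [CommRing K] [CommRing F] [Algebra K F]
    (d : Der F) (L : K[X]) (f : F) : F :=
  L.sum fun i a => algebraMap K F a * (⇑d)^[i] f

/-- `M` annihilates `f g` whenever `f` is a solution of `L` and `g` is a solution of `Q`, in any
commutative differential ring `(F, d)` extending `(K, δ)`. -/
def AnnihilatesProducts {K : Type u} [Field K] (δ : Der K) (L Q M : K[X]) : Prop :=
  ∀ (F : Type u) [CommRing F] [Algebra K F] (d : Der F),
    (∀ a : K, d (algebraMap K F a) = algebraMap K F (δ a)) →
    ∀ f g : F, apply d L f = 0 → apply d Q g = 0 → apply d M (f * g) = 0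

/-- `M` is a symmetric product `L ⊗ Q` in `K[D]`, for the differential field `(K, δ)`: a nonzero
operator of lowest order among those annihilating all products of a solution of `L` and a solution
of `Q`. It is unique up to multiplication from the left by a nonzero element of `K`. -/
structure IsSymmetricProduct {K : Type u} [Field K] (δ : Der K) (L Q M : K[X]) :
    Prop where
  ne_zero : M ≠ 0
  annihilates : AnnihilatesProducts δ L Q M
  minimal : ∀ N : K[X], N ≠ 0 → AnnihilatesProducts δ L Q N → M.natDegree ≤ N.natDegree

/-- The operator product `(D + u) L`. -/
noncomputable def dMul {K : Type*} [CommRing K] (δ : Der K) (u : K) (L : K[X]) : K[X] :=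
  (L.sum fun i a => monomial i (δ a + u * a)) + X * L

/-- The conjugate `E⁻¹ L E` of the operator `L`, where `E` satisfies `E' = u E`:
since `E⁻¹ D E = D + u`, it is `∑ ℓᵢ (D + u)ⁱ`. -/
noncomputable def conj {K : Type*} [CommRing K] (δ : Der K) (u : K) (L : K[X]) : K[X] :=
  L.sum fun i a => C a * (dMul δ u)^[i] 1

theorem apply_add {K F : Type*} [CommRing K] [CommRing F] [Algebra K F]
    (d : Der F) (L M : K[X]) (f : F) :
    apply d (L + M) f = apply d L f + apply d M f := by
  unfold apply
  exact Polynomial.sum_add_index _ _ _ (by simp) (by intros; simp [add_mul])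

theorem apply_monomial {K F : Type*} [CommRing K] [CommRing F] [Algebra K F]
    (d : Der F) (i : ℕ) (a : K) (f : F) :
    apply d (monomial i a) f = algebraMap K F a * (⇑d)^[i] f := by
  unfold apply
  exact Polynomial.sum_monomial_index _ _ (by simp)

theorem apply_finset_sum {K F ι : Type*} [CommRing K] [CommRing F] [Algebra K F]
    (d : Der F) (s : Finset ι) (L : ι → K[X]) (f : F) :
    apply d (∑ i ∈ s, L i) f = ∑ i ∈ s, apply d (L i) f := by
  classical
  induction s using Finset.induction_on with
  | empty => simp [apply]
  | insert a s ha ih => rw [Finset.sum_insert ha, Finset.sum_insert ha, apply_add, ih]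

theorem apply_C_mul {K F : Type*} [CommRing K] [CommRing F] [Algebra K F]
    (d : Der F) (a : K) (L : K[X]) (f : F) :
    apply d (C a * L) f = algebraMap K F a * apply d L f := by
  induction L using Polynomial.induction_on' with
  | add p q hp hq => rw [mul_add, apply_add, apply_add, hp, hq, mul_add]
  | monomial n b => rw [C_mul_monomial, apply_monomial, apply_monomial, map_mul, mul_assoc]

theorem apply_dMul {K F : Type*} [CommRing K] [CommRing F] [Algebra K F]
    (δ : Der K) (d : Der F)
    (hd : ∀ a : K, d (algebraMap K F a) = algebraMap K F (δ a)) (u : K) (L : K[X]) (f : F) :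
    apply d (dMul δ u L) f = d (apply d L f) + algebraMap K F u * apply d L f := by
  have hadd : ∀ p q : K[X], dMul δ u (p + q) = dMul δ u p + dMul δ u q := by
    intro p q
    unfold dMul
    rw [Polynomial.sum_add_index p q _ (by simp)
      (by intros; rw [← map_add]; congr 1; rw [map_add]; ring)]
    ring
  induction L using Polynomial.induction_on' with
  | add p q hp hq => rw [hadd, apply_add, apply_add, hp, hq, map_add]; ring
  | monomial n b =>
    unfold dMul
    rw [Polynomial.sum_monomial_index _ _ (by simp), X_mul_monomial, apply_add, apply_monomial,
      apply_monomial, apply_monomial, Derivation.leibniz, hd, Function.iterate_succ_apply']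
    simp only [smul_eq_mul, map_add, map_mul]
    ring

/-- `conj δ u L` is indeed `E⁻¹ L E` for every `E` with `E' = u E`. -/
theorem apply_conj {K F : Type*} [CommRing K] [CommRing F] [Algebra K F]
    (δ : Der K) (d : Der F)
    (hd : ∀ a : K, d (algebraMap K F a) = algebraMap K F (δ a)) (u : K) (L : K[X]) (E f : F)
    (hE : d E = algebraMap K F u * E) :
    E * apply d (conj δ u L) f = apply d L (E * f) := by
  have key : ∀ i : ℕ, E * apply d ((dMul δ u)^[i] 1) f = (⇑d)^[i] (E * f) := by
    intro i
    induction i with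
    | zero =>
      have : (1 : K[X]) = monomial 0 1 := rfl
      simp only [Function.iterate_zero, id]
      rw [this, apply_monomial]; simp
    | succ n ih =>
      rw [Function.iterate_succ_apply', Function.iterate_succ_apply', ← ih, apply_dMul δ d hd,
        Derivation.leibniz, hE]
      simp only [smul_eq_mul]
      ring
  unfold conj
  rw [Polynomial.sum_def, apply_finset_sum, Finset.mul_sum]
  conv_rhs => unfold apply
  rw [Polynomial.sum_def]
  refine Finset.sum_congr rfl fun i _ => ?_
  rw [apply_C_mul, ← key]
  ring

/-- In the solutions of `L`, of order `r`, every derivative of order at most `r` is a universal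
linear combination of the derivatives of order less than `r`. -/
theorem exists_reduction {K : Type u} [Field K] (L : K[X]) (hL : L ≠ 0) (n : ℕ)
    (hn : n ≤ L.natDegree) :
    ∃ a : Fin L.natDegree → K, ∀ (F : Type u) [CommRing F] [Algebra K F] (d : Der F)
      (f : F), apply d L f = 0 → (⇑d)^[n] f = ∑ i, algebraMap K F (a i) * (⇑d)^[i] f := by
  rcases hn.lt_or_eq with h | h
  · refine ⟨Pi.single ⟨n, h⟩ 1, fun F _ _ d f _ => ?_⟩
    rw [Finset.sum_eq_single ⟨n, h⟩]
    · simp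
    · intro b _ hb; simp [hb]
    · simp
  · refine ⟨fun i => -(L.coeff i / L.leadingCoeff), fun F _ _ d f hf => ?_⟩
    unfold apply at hf
    rw [Polynomial.sum_over_range _ (by simp), Finset.sum_range_succ, Finset.sum_range] at hf
    have h0 : L.leadingCoeff ≠ 0 := leadingCoeff_ne_zero.mpr hL
    have h1 : algebraMap K F (L.leadingCoeff⁻¹) * algebraMap K F (L.coeff L.natDegree) = 1 := by
      rw [← map_mul, ← map_one (algebraMap K F), coeff_natDegree, inv_mul_cancel₀ h0]
    have h2 := congrArg (fun z => algebraMap K F (L.leadingCoeff⁻¹) * z) hf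
    simp only [mul_add, mul_zero, ← mul_assoc, h1, one_mul] at h2
    rw [h, eq_neg_of_add_eq_zero_right h2, Finset.mul_sum, ← Finset.sum_neg_distrib]
    refine Finset.sum_congr rfl fun i _ => ?_
    rw [← mul_assoc, ← map_mul, ← neg_mul, ← map_neg]
    congr 2
    field_simp

/-- Symmetric products of nonzero operators exist. -/
theorem exists_isSymmetricProduct {K : Type u} [Field K] (δ : Der K) (L Q : K[X])
    (hL : L ≠ 0) (hQ : Q ≠ 0) : ∃ M, IsSymmetricProduct δ L Q M := by
  classical
  have hann : ∃ M : K[X], M ≠ 0 ∧ AnnihilatesProducts δ L Q M := by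
    have hLr := exists_reduction L hL
    have hQr := exists_reduction Q hQ
    choose a ha using hLr
    choose b hb using hQr
    let V := Fin L.natDegree → Fin Q.natDegree → K
    let st : V → V := fun w k l => δ (w k l) + (∑ i, w i l * a (i + 1) i.2 k)
      + ∑ j, w k j * b (j + 1) j.2 l
    let c : ℕ → V := fun n => st^[n] (fun i j => a 0 (Nat.zero_le _) i * b 0 (Nat.zero_le _) j)
    have hc : ∀ (n : ℕ) (F : Type u) [CommRing F] [Algebra K F] (d : Der F),
        (∀ a : K, d (algebraMap K F a) = algebraMap K F (δ a)) →
        ∀ f g : F, apply d L f = 0 → apply d Q g = 0 →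
        (⇑d)^[n] (f * g) =
          ∑ i, ∑ j, algebraMap K F (c n i j) * ((⇑d)^[i] f * (⇑d)^[j] g) := by
      intro n F _ _ d hd f g hf hg
      induction n with
      | zero =>
        have h1 := ha 0 (Nat.zero_le _) F d f hf
        have h2 := hb 0 (Nat.zero_le _) F d g hg
        simp only [Function.iterate_zero, id] at h1 h2 ⊢
        conv_lhs => rw [h1, h2]
        rw [Finset.sum_mul_sum]
        refine Finset.sum_congr rfl fun i _ => Finset.sum_congr rfl fun j _ => ?_
        simp only [c, Function.iterate_zero, id, map_mul]
        ring
      | succ n ih =>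
        have hcs : c (n + 1) = st (c n) := Function.iterate_succ_apply' _ _ _
        rw [Function.iterate_succ_apply', ih, hcs, map_sum]
        simp only [map_sum, Derivation.leibniz, hd, ← Function.iterate_succ_apply', smul_eq_mul]
        have e1 : ∀ i : Fin L.natDegree, (⇑d)^[(i : ℕ) + 1] f =
            ∑ k, algebraMap K F (a (i + 1) i.2 k) * (⇑d)^[k] f := fun i => ha _ i.2 F d f hf
        have e2 : ∀ j : Fin Q.natDegree, (⇑d)^[(j : ℕ) + 1] g =
            ∑ l, algebraMap K F (b (j + 1) j.2 l) * (⇑d)^[l] g := fun j => hb _ j.2 F d g hg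
        simp only [Nat.succ_eq_add_one, e1, e2, st, map_add, map_sum, map_mul, add_mul, mul_add,
          Finset.sum_add_distrib, Finset.mul_sum, Finset.sum_mul]
        have t1 : ∀ G : Fin L.natDegree → Fin Q.natDegree → Fin L.natDegree → F,
            ∑ x, ∑ y, ∑ i, G x y i = ∑ i, ∑ y, ∑ x, G x y i := by
          intro G
          rw [Finset.sum_comm]
          conv_rhs => rw [Finset.sum_comm]
          exact Finset.sum_congr rfl fun y _ => Finset.sum_comm
        have t2 : ∀ G : Fin L.natDegree → Fin Q.natDegree → Fin Q.natDegree → F,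
            ∑ x, ∑ y, ∑ i, G x y i = ∑ x, ∑ i, ∑ y, G x y i := by
          intro G
          exact Finset.sum_congr rfl fun x _ => Finset.sum_comm
        conv_rhs =>
          rw [t1 (fun x y i => algebraMap K F (c n i y) * algebraMap K F (a (i + 1) i.2 x) *
            ((⇑d)^[x] f * (⇑d)^[y] g))]
          rw [t2 (fun x y i => algebraMap K F (c n x i) * algebraMap K F (b (i + 1) i.2 y) *
            ((⇑d)^[x] f * (⇑d)^[y] g))]
        have s1 : ∀ (x : Fin L.natDegree) (y : Fin Q.natDegree) (i : Fin Q.natDegree),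
          algebraMap K F (c n x y) * ((⇑d)^[x] f * (algebraMap K F (b (y + 1) y.2 i) * (⇑d)^[i] g))
          = algebraMap K F (c n x y) * algebraMap K F (b (y + 1) y.2 i) *
            ((⇑d)^[x] f * (⇑d)^[i] g) := by intros; ring
        have s2 : ∀ (x : Fin L.natDegree) (y : Fin Q.natDegree) (i : Fin L.natDegree),
          algebraMap K F (c n x y) * ((⇑d)^[y] g * (algebraMap K F (a (x + 1) x.2 i) * (⇑d)^[i] f))
          = algebraMap K F (c n x y) * algebraMap K F (a (x + 1) x.2 i) *
            ((⇑d)^[i] f * (⇑d)^[y] g) := by intros; ring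
        have s3 : ∀ (x : Fin L.natDegree) (y : Fin Q.natDegree),
          (⇑d)^[x] f * (⇑d)^[y] g * algebraMap K F (δ (c n x y)) =
            algebraMap K F (δ (c n x y)) * ((⇑d)^[x] f * (⇑d)^[y] g) := by intros; ring
        simp only [s1, s2, s3]
        abel
    have hdep : ¬ LinearIndependent K
        (fun n : Fin (Module.finrank K V + 1) => c n) := by
      intro h
      have := h.fintype_card_le_finrank
      simp at this
    rw [Fintype.not_linearIndependent_iff] at hdep
    obtain ⟨z, hz, i0, hi0⟩ := hdep
    refine ⟨∑ n : Fin (Module.finrank K V + 1), monomial (n : ℕ) (z n), ?_, ?_⟩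
    · intro h
      apply hi0
      have := congrArg (fun p => Polynomial.coeff p (i0 : ℕ)) h
      simp only [finsetSum_coeff, coeff_monomial, coeff_zero] at this
      rw [Finset.sum_eq_single i0] at this
      · simpa using this
      · intro j _ hj
        rw [if_neg]
        exact fun h => hj (Fin.ext h)
      · simp
    · intro F _ _ d hd f g hf hg
      rw [apply_finset_sum]
      simp only [apply_monomial, hc _ F d hd f g hf hg, Finset.mul_sum]
      rw [Finset.sum_comm]
      refine Finset.sum_eq_zero fun i _ => ?_
      rw [Finset.sum_comm]
      refine Finset.sum_eq_zero fun j _ => ?_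
      simp only [← mul_assoc, ← map_mul]
      rw [← Finset.sum_mul, ← Finset.sum_mul, ← map_sum]
      have hzij : ∑ n : Fin (Module.finrank K V + 1), z n * c n i j = 0 := by
        have h := congrFun (congrFun hz i) j
        erw [Finset.sum_apply, Finset.sum_apply] at h
        exact h
      rw [hzij]
      simp
  let S : Set ℕ := {n | ∃ M : K[X], M ≠ 0 ∧ AnnihilatesProducts δ L Q M ∧ M.natDegree = n}
  obtain ⟨M₀, h0, h0'⟩ := hann
  have hS : S.Nonempty := ⟨_, M₀, h0, h0', rfl⟩
  obtain ⟨M, hM, hM', hdeg⟩ := Nat.sInf_mem hS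
  exact ⟨M, hM, hM', fun N hN hN' => hdeg ▸ Nat.sInf_le ⟨N, hN, hN', rfl⟩⟩

/-! ### The differential fields -/

/-- A derivation of a commutative ring from an additive map satisfying the product rule. -/
def mkDerivation {A : Type*} [CommRing A] (φ : A → A) (hadd : ∀ a b, φ (a + b) = φ a + φ b)
    (hmul : ∀ a b, φ (a * b) = a * φ b + b * φ a) : Der A :=
  Derivation.mk' (AddMonoidHom.mk' φ hadd).toIntLinearMap hmul

/-- The value of `d/dx` on a rational function, by the quotient rule. -/
noncomputable def ratDerivFun {k : Type*} [Field k] (f : RatFunc k) : RatFunc k :=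
  algebraMap k[X] (RatFunc k) (derivative f.num * f.denom - f.num * derivative f.denom) /
    algebraMap k[X] (RatFunc k) (f.denom ^ 2)

theorem ratDerivFun_div {k : Type*} [Field k] (a b : k[X]) (hb : b ≠ 0) :
    ratDerivFun (algebraMap k[X] (RatFunc k) a / algebraMap k[X] (RatFunc k) b) =
      algebraMap k[X] (RatFunc k) (derivative a * b - a * derivative b) /
        algebraMap k[X] (RatFunc k) (b ^ 2) := by
  set f := algebraMap k[X] (RatFunc k) a / algebraMap k[X] (RatFunc k) b with hf
  have hinj := IsFractionRing.injective k[X] (RatFunc k)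
  have h0 : f.denom ≠ 0 := f.denom_ne_zero
  have hb' : algebraMap k[X] (RatFunc k) b ≠ 0 := (map_ne_zero_iff _ hinj).mpr hb
  have h0' : algebraMap k[X] (RatFunc k) f.denom ≠ 0 := (map_ne_zero_iff _ hinj).mpr h0
  have h1 : f.num * b = a * f.denom := by
    apply hinj
    rw [map_mul, map_mul]
    have := RatFunc.num_div_denom f
    rw [div_eq_iff h0'] at this
    rw [this, hf]
    field_simp
  have h2 : derivative f.num * b + f.num * derivative b =
      derivative a * f.denom + a * derivative f.denom := by
    have := congrArg derivative h1
    simpa only [derivative_mul] using this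
  unfold ratDerivFun
  rw [div_eq_div_iff (by simpa using h0') (by simpa using hb'), ← map_mul, ← map_mul]
  congr 1
  linear_combination (f.denom * b) * h2 - (f.denom * derivative b + b * derivative f.denom) * h1

theorem ratDerivFun_add {k : Type*} [Field k] (f g : RatFunc k) :
    ratDerivFun (f + g) = ratDerivFun f + ratDerivFun g := by
  have hinj := IsFractionRing.injective k[X] (RatFunc k)
  induction f using RatFunc.induction_on with | f a b hb => ?_
  induction g using RatFunc.induction_on with | f c e he => ?_
  have hb' : algebraMap k[X] (RatFunc k) b ≠ 0 := (map_ne_zero_iff _ hinj).mpr hb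
  have he' : algebraMap k[X] (RatFunc k) e ≠ 0 := (map_ne_zero_iff _ hinj).mpr he
  rw [div_add_div _ _ hb' he', ← map_mul, ← map_mul, ← map_mul, ← map_add,
    ratDerivFun_div _ _ hb, ratDerivFun_div _ _ he, ratDerivFun_div _ _ (mul_ne_zero hb he)]
  simp only [derivative_mul, map_sub, map_add, map_mul, map_pow]
  field_simp
  ring

theorem ratDerivFun_mul {k : Type*} [Field k] (f g : RatFunc k) :
    ratDerivFun (f * g) = f * ratDerivFun g + g * ratDerivFun f := by
  have hinj := IsFractionRing.injective k[X] (RatFunc k)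
  induction f using RatFunc.induction_on with | f a b hb => ?_
  induction g using RatFunc.induction_on with | f c e he => ?_
  have hb' : algebraMap k[X] (RatFunc k) b ≠ 0 := (map_ne_zero_iff _ hinj).mpr hb
  have he' : algebraMap k[X] (RatFunc k) e ≠ 0 := (map_ne_zero_iff _ hinj).mpr he
  rw [div_mul_div_comm, ← map_mul, ← map_mul,
    ratDerivFun_div _ _ hb, ratDerivFun_div _ _ he, ratDerivFun_div _ _ (mul_ne_zero hb he)]
  simp only [derivative_mul, map_sub, map_add, map_mul, map_pow]
  field_simp
  ring

/-- The derivation `d/dx` of the field `k(x)` of rational functions. -/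
noncomputable def ratDeriv (k : Type*) [Field k] : Der (RatFunc k) :=
  mkDerivation ratDerivFun ratDerivFun_add ratDerivFun_mul

/-- The value of `x d/dx` on a generalized series `∑ aₑ xᵉ`, namely `∑ e aₑ xᵉ`. -/
noncomputable def hahnEuler {k : Type*} [Field k] (f : HahnSeries ℚ k) : HahnSeries ℚ k where
  coeff e := (e : k) * f.coeff e
  isPWO_support' := f.isPWO_support.mono fun e he => by
    simp only [Function.mem_support] at he
    exact right_ne_zero_of_mul he

theorem hahnEuler_mul {k : Type*} [Field k] [CharZero k] (f g : HahnSeries ℚ k) :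
    hahnEuler (f * g) = f * hahnEuler g + g * hahnEuler f := by
  have hs : ∀ h : HahnSeries ℚ k, (hahnEuler h).support ⊆ h.support := fun h e he => by
    simp only [HahnSeries.mem_support, hahnEuler] at he ⊢
    exact right_ne_zero_of_mul he
  rw [mul_comm g]
  ext e
  rw [HahnSeries.coeff_add, HahnSeries.coeff_mul_right' g.isPWO_support (hs g),
    HahnSeries.coeff_mul_left' f.isPWO_support (hs f)]
  simp only [hahnEuler]
  rw [HahnSeries.coeff_mul, Finset.mul_sum, ← Finset.sum_add_distrib]
  refine Finset.sum_congr rfl fun ij hij => ?_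
  rw [Finset.mem_antidiagonal] at hij
  rw [← hij.2.2, Rat.cast_add]
  ring

/-- The derivation `d/dx` of the field of generalized series with exponents in `ℚ`, which contains
the Laurent series in `x^(1/v)` for all `v`. It maps `xᵉ` to `e x^(e-1)`. -/
noncomputable def hahnDeriv (k : Type*) [Field k] [CharZero k] :
    Der (HahnSeries ℚ k) :=
  mkDerivation (fun f : HahnSeries ℚ k => HahnSeries.single (-1 : ℚ) 1 * hahnEuler f)
    (fun f g => by
      have : hahnEuler (f + g) = hahnEuler f + hahnEuler g := by
        ext e; simp [hahnEuler, mul_add]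
      rw [this, mul_add])
    (fun f g => by
      rw [hahnEuler_mul]
      ring)

theorem eval₂_hahn_injective (k : Type*) [Field k] : Function.Injective
    (eval₂RingHom (HahnSeries.C : k →+* HahnSeries ℚ k) (HahnSeries.single (1 : ℚ) 1)) := by
  rw [injective_iff_map_eq_zero]
  intro p hp
  ext n
  have h := congrArg (fun f : HahnSeries ℚ k => f.coeff (n : ℚ)) hp
  simp only [coe_eval₂RingHom, HahnSeries.coeff_zero] at h
  rw [eval₂_eq_sum, Polynomial.sum_def, HahnSeries.coeff_sum] at h
  simp only [HahnSeries.single_pow, one_pow, HahnSeries.C_apply, HahnSeries.single_mul_single,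
    HahnSeries.coeff_single, nsmul_eq_mul, mul_one, zero_add, Nat.cast_inj] at h
  simpa using h

/-- The expansion at `x = 0` of a rational function: the ring homomorphism over `k` that maps `x`
to the series `x¹`. -/
noncomputable def ratToHahn (k : Type*) [Field k] : RatFunc k →+* HahnSeries ℚ k :=
  IsFractionRing.lift (eval₂_hahn_injective k)

/-- `p(x⁻¹) = ∑ aᵢ x^(-i/v)` for the fractional polynomial `p(x) = ∑ aᵢ x^(i/v)` of `k[x^(1/v)]`,
which is given by the polynomial `∑ aᵢ Xⁱ`. -/
noncomputable def expPart {k : Type*} [Field k] (p : k[X]) (v : ℕ) : HahnSeries ℚ k :=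
  p.sum fun i a => HahnSeries.single (-((i : ℚ) / (v : ℚ))) a

/-! ### Indicial polynomials -/

/-- The coefficient (a polynomial in `s`) of `x^(s+e)` in `N · xˢ`. For `N = ∑ ℓᵢ Dⁱ` we have
`N · xˢ = ∑ ℓᵢ s(s-1)⋯(s-i+1) x^(s-i)`. -/
noncomputable def indicialCoeff {k : Type*} [Field k] (N : (HahnSeries ℚ k)[X]) (e : ℚ) : k[X] :=
  N.sum fun i a => C (a.coeff (e + i)) * descPochhammer k i

open Classical in
/-- The indicial polynomial at `0`: if `N · xˢ = x^(s+σ) (p₀(s) + ∑_{e > 0} pₑ(s) xᵉ)` with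
`p₀ ≠ 0`, it is `p₀`. (The value is `0` for `N = 0`.) -/
noncomputable def indicial {k : Type*} [Field k] (N : (HahnSeries ℚ k)[X]) : k[X] :=
  if h : ∃ σ, IsLeast {e | indicialCoeff N e ≠ 0} σ then indicialCoeff N h.choose else 0

theorem indicial_ne_zero {k : Type*} [Field k] (N : (HahnSeries ℚ k)[X]) (hN : N ≠ 0) :
    indicial N ≠ 0 := by
  have hex : ∃ σ, IsLeast {e | indicialCoeff N e ≠ 0} σ := by
    have hpwo : {e | indicialCoeff N e ≠ 0}.IsPWO := by
      have hsub : {e | indicialCoeff N e ≠ 0} ⊆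
          ⋃ i ∈ N.support, (fun x : ℚ => x - i) '' (N.coeff i).support := by
        intro e he
        by_contra hcon
        apply he
        unfold indicialCoeff
        rw [Polynomial.sum_def]
        refine Finset.sum_eq_zero fun i hi => ?_
        have : (N.coeff i).coeff (e + i) = 0 := by
          by_contra h
          apply hcon
          simp only [Set.mem_iUnion]
          exact ⟨i, hi, e + i, h, by simp⟩
        rw [this, C_0, zero_mul]
      refine Set.IsPWO.mono ?_ hsub
      refine (Finset.isPWO_bUnion N.support).mpr fun i _ => ?_
      exact (N.coeff i).isPWO_support.image_of_monotone
        (fun a b hab => by simpa using hab)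
    have hne : {e | indicialCoeff N e ≠ 0}.Nonempty := by
      have hl : N.leadingCoeff ≠ 0 := leadingCoeff_ne_zero.mpr hN
      refine ⟨N.leadingCoeff.order - N.natDegree, fun h => ?_⟩
      have h1 := congrArg (fun p => Polynomial.coeff p N.natDegree) h
      unfold indicialCoeff at h1
      rw [Polynomial.sum_def] at h1
      simp only [finsetSum_coeff, coeff_C_mul, coeff_zero] at h1
      rw [Finset.sum_eq_single N.natDegree] at h1
      · have h2 : (descPochhammer k N.natDegree).coeff N.natDegree = 1 := by
          have := (monic_descPochhammer k N.natDegree).coeff_natDegree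
          rwa [descPochhammer_natDegree] at this
        rw [h2, mul_one, sub_add_cancel, coeff_natDegree] at h1
        exact hl (HahnSeries.coeff_order_eq_zero.mp h1)
      · intro j hj hjn
        have : j < N.natDegree := lt_of_le_of_ne (le_natDegree_of_mem_supp j hj) hjn
        rw [coeff_eq_zero_of_natDegree_lt (p := descPochhammer k j)
            (by rwa [descPochhammer_natDegree]), mul_zero]
      · intro h
        exact absurd (natDegree_mem_support_of_nonzero hN) h
    exact ⟨_, hpwo.isWF.min_mem hne, fun b hb => hpwo.isWF.min_le hne hb⟩
  unfold indicial
  rw [dif_pos hex]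
  exact hex.choose_spec.1

/-- The indicial polynomial `ind₀(L)` at `0` of `L ∈ k(x)[D]`. The coefficients of `L` are expanded
at `0`; multiplying `L` from the left by a nonzero rational function, e.g. to clear denominators,
changes the result by a nonzero constant factor only. -/
noncomputable def ind₀ {k : Type*} [Field k] (L : (RatFunc k)[X]) : k[X] :=
  indicial (L.map (ratToHahn k))

/-- The generalized indicial polynomial of `L ∈ k(x)[D]` at `0` and `exp(p(x⁻¹))`, for
`p ∈ k[x^(1/v)]`: the indicial polynomial of `exp(-p(x⁻¹)) L exp(p(x⁻¹))`. -/
noncomputable def genInd₀ {k : Type*} [Field k] [CharZero k] (v : ℕ) (p : k[X])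
    (L : (RatFunc k)[X]) : k[X] :=
  indicial (conj (hahnDeriv k) (hahnDeriv k (expPart p v)) (L.map (ratToHahn k)))

end DiffOp

namespace DiffOp

/-! Let `R` be a symmetric product of the two indicial polynomials. Over constants Euclidean
division shows that `R` divides every polynomial annihilating all products `f g` of their solutions
(`IsSymmetricProduct.dvd`). So it suffices that the indicial polynomial of the conjugated `M`
annihilates these products in every differential ring.

Annihilation of products survives expansion at `0` (`AnnihilatesProducts.map`) and conjugation by
exponentials, which are adjoined formally (`AnnihilatesProducts.conj`). What remains is Frobenius'
method over the field of generalized series (`AnnihilatesProducts.indicial`). A solution `f` of an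
indicial polynomial in `(F, d)` becomes, by Taylor expansion, a solution in `(F⟦t⟧, d/dt)`, where
`t` plays the role of `log x`: on `xᵉ a` with `a` in `F⟦t⟧`, the operator `x d/dx` acts as `e +
d/dt`. Nonzero constant-coefficient operators are surjective on `F⟦t⟧`, so `f` is the leading term
of a series solution of the operator itself (`exists_series_solution`). The product of two such
series is annihilated by the operator `M`, hence its leading term `f g` is annihilated by the
indicial polynomial (`aeval_indicial_of_apply_eq_zero`). Taking constant terms in `t` returns to
`F`. -/

/-! ### Base change and adjunction of exponentials -/

theorem map_apply_of_commute {K K' F F' : Type*} [CommRing K] [CommRing K'] [CommRing F]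
    [CommRing F'] [Algebra K F] [Algebra K' F'] (ψ : K →+* K') (φ : F →+* F')
    (hφ : ∀ a, φ (algebraMap K F a) = algebraMap K' F' (ψ a)) (d : Der F) (d' : Der F')
    (hd : ∀ x, φ (d x) = d' (φ x)) (L : K[X]) (f : F) :
    φ (apply d L f) = apply d' (L.map ψ) (φ f) := by
  have hiter : ∀ i : ℕ, φ ((⇑d)^[i] f) = (⇑d')^[i] (φ f) := fun i =>
    (Function.Semiconj.iterate_right (f := φ) (ga := d) (gb := d') hd i).eq f
  induction L using Polynomial.induction_on' with
  | add p q hp hq => rw [apply_add, map_add, hp, hq, Polynomial.map_add, apply_add]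
  | monomial n b =>
    rw [map_monomial, apply_monomial, apply_monomial, map_mul, hφ, hiter]

/-- Restriction of scalars along `ψ` turns each differential extension of `K'` into one of `K`, with
the same solutions. -/
theorem AnnihilatesProducts.map {K K' : Type u} [Field K] [Field K'] {δ : Der K} {δ' : Der K'}
    (ψ : K →+* K') (hψ : ∀ a, δ' (ψ a) = ψ (δ a)) {L Q M : K[X]}
    (h : AnnihilatesProducts δ L Q M) :
    AnnihilatesProducts δ' (L.map ψ) (Q.map ψ) (M.map ψ) := by
  intro F _ _ d hd f g hf hg
  let _ : Algebra K F := ((algebraMap K' F).comp ψ).toAlgebra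
  have key : ∀ (N : K[X]) (x : F), apply d N x = apply d (N.map ψ) x := fun N x =>
    map_apply_of_commute ψ (RingHom.id F) (fun _ => rfl) d d (fun _ => rfl) N x
  rw [← key] at hf hg ⊢
  refine h F d (fun a => ?_) f g hf hg
  change d (algebraMap K' F (ψ a)) = algebraMap K' F (ψ (δ a))
  rw [hd, hψ]

/-- The extension of the derivation `d` to the ring `F[Y]/(Y²)` with `Y' = u Y`. -/
def dualDer {F : Type*} [CommRing F] (d : Der F) (u : F) : Der (DualNumber F) :=
  mkDerivation (fun x => TrivSqZeroExt.inl (d x.fst) + TrivSqZeroExt.inr (d x.snd + u * x.snd))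
    (fun a b => by ext <;> simp; ring)
    (fun a b => by ext <;> simp; ring)

theorem dualDer_inl {F : Type*} [CommRing F] (d : Der F) (u a : F) :
    dualDer d u (TrivSqZeroExt.inl a) = TrivSqZeroExt.inl (d a) := by
  ext <;> simp [dualDer, mkDerivation]

theorem dualDer_inr {F : Type*} [CommRing F] (d : Der F) (u a : F) :
    dualDer d u (TrivSqZeroExt.inr a) = TrivSqZeroExt.inr (d a + u * a) := by
  ext <;> simp [dualDer, mkDerivation]

theorem algebraMap_dualNumber {K F : Type*} [CommRing K] [CommRing F] [Algebra K F] (a : K) :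
    algebraMap K (DualNumber F) a = TrivSqZeroExt.inl (algebraMap K F a) := rfl

theorem dualDer_eps {K F : Type*} [CommRing K] [CommRing F] [Algebra K F] (d : Der F) (w : K) :
    dualDer d (algebraMap K F w) (TrivSqZeroExt.inr 1) =
      algebraMap K (DualNumber F) w * TrivSqZeroExt.inr 1 := by
  rw [dualDer_inr, algebraMap_dualNumber, TrivSqZeroExt.inl_mul_inr]
  simp

/-- Products of `Y`-multiples and `Z`-multiples of elements of `F`, for exponentials `Y` and `Z`
adjoined to `F`. -/
theorem apply_conj_add_eq_zero {K F F' : Type*} [CommRing K] [CommRing F] [CommRing F']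
    [Algebra K F] [Algebra K F'] {δ : Der K} (d : Der F) (d' : Der F') (ι : F →+* F')
    (hι : ∀ a, ι (algebraMap K F a) = algebraMap K F' a) (hdι : ∀ x, ι (d x) = d' (ι x))
    (hd' : ∀ a : K, d' (algebraMap K F' a) = algebraMap K F' (δ a)) (u w : K) {Y Z : F'}
    (hY : d' Y = algebraMap K F' u * Y) (hZ : d' Z = algebraMap K F' w * Z)
    (hYZ : ∀ x, Y * Z * ι x = 0 → x = 0) {L Q M : K[X]}
    (hM : ∀ f g : F', apply d' L f = 0 → apply d' Q g = 0 → apply d' M (f * g) = 0) {f g : F}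
    (hf : apply d (conj δ u L) f = 0) (hg : apply d (conj δ w Q) g = 0) :
    apply d (conj δ (u + w) M) (f * g) = 0 := by
  have hιN : ∀ (N : K[X]) (x : F), apply d' N (ι x) = ι (apply d N x) := fun N x => by
    rw [map_apply_of_commute (RingHom.id K) ι hι d d' hdι N x, Polynomial.map_id]
  have hYZ' : d' (Y * Z) = algebraMap K F' (u + w) * (Y * Z) := by
    rw [Derivation.leibniz, hY, hZ, map_add, smul_eq_mul, smul_eq_mul]; ring
  have h1 := apply_conj δ d' hd' u L Y (ι f) hY
  have h2 := apply_conj δ d' hd' w Q Z (ι g) hZ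
  rw [hιN, hf, map_zero, mul_zero] at h1
  rw [hιN, hg, map_zero, mul_zero] at h2
  have h3 := hM _ _ h1.symm h2.symm
  rw [mul_mul_mul_comm, ← map_mul, ← apply_conj δ d' hd' (u + w) M (Y * Z) _ hYZ', hιN] at h3
  exact hYZ _ h3

/-- The hypothesis may be tested in any extension of `F`, so `Y' = uY` and `Z' = wZ` can be
adjoined. Invertibility of `Y` and `Z` is not needed, only that `YZ` kills no nonzero element of
`F`; the ring `F[Y, Z]/(Y², Z²)`, an iterated `DualNumber`, is enough. -/
theorem AnnihilatesProducts.conj {K : Type u} [Field K] {δ : Der K} {L Q M : K[X]}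
    (h : AnnihilatesProducts δ L Q M) (u w : K) :
    AnnihilatesProducts δ (conj δ u L) (conj δ w Q) (conj δ (u + w) M) := by
  intro F _ _ d hd f g hf hg
  let d₁ : Der (DualNumber F) := dualDer d (algebraMap K F u)
  let d₂ : Der (DualNumber (DualNumber F)) := dualDer d₁ (algebraMap K (DualNumber F) w)
  have hd₁ : ∀ a : K, d₁ (algebraMap K _ a) = algebraMap K _ (δ a) := fun a => by
    rw [algebraMap_dualNumber, dualDer_inl, hd, algebraMap_dualNumber]
  have hd₂ : ∀ a : K, d₂ (algebraMap K _ a) = algebraMap K _ (δ a) := fun a => by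
    rw [algebraMap_dualNumber, dualDer_inl, hd₁]
    rfl
  refine apply_conj_add_eq_zero (δ := δ) d d₂
    ((TrivSqZeroExt.inlHom (DualNumber F) (DualNumber F)).comp (TrivSqZeroExt.inlHom F F))
    (fun _ => rfl) (fun x => ?_) hd₂ u w (Y := TrivSqZeroExt.inl (TrivSqZeroExt.inr 1))
    (Z := TrivSqZeroExt.inr 1) ?_ (dualDer_eps d₁ w) (fun x hx => ?_)
    (fun f g => h _ d₂ hd₂ f g) hf hg
  · change _ = d₂ (TrivSqZeroExt.inl (TrivSqZeroExt.inl x))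
    rw [dualDer_inl, dualDer_inl]
    rfl
  · rw [dualDer_inl, dualDer_eps, TrivSqZeroExt.inl_mul]
    rfl
  -- The double `snd` reads off the coefficient of `YZ`, which is `x`.
  · have h4 := congrArg (fun z => TrivSqZeroExt.snd (TrivSqZeroExt.snd z)) hx
    simpa using h4

/-! ### Conjugated operators -/

theorem natDegree_dMul_iterate_one {K : Type*} [Field K] (δ : Der K) (u : K) (i : ℕ) :
    ((dMul δ u)^[i] 1).Monic ∧ ((dMul δ u)^[i] 1).natDegree = i := by
  induction i with
  | zero => simp
  | succ n ih =>
    rw [Function.iterate_succ_apply']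
    set P := (dMul δ u)^[n] 1
    obtain ⟨hm, hn⟩ := ih
    have hX : (X * P).Monic := monic_X.mul hm
    have hXd : (X * P).natDegree = n + 1 := by rw [natDegree_X_mul hm.ne_zero, hn]
    have hlow : (P.sum fun i a => monomial i (δ a + u * a)).degree < (X * P).degree := by
      rw [degree_eq_natDegree hX.ne_zero, hXd, Polynomial.sum_def]
      refine (degree_sum_le _ _).trans_lt ((Finset.sup_lt_iff (WithBot.bot_lt_coe _)).2 ?_)
      intro j hj
      refine (degree_monomial_le _ _).trans_lt ?_
      have := le_natDegree_of_mem_supp _ hj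
      exact_mod_cast (by omega : j < n + 1)
    unfold dMul
    exact ⟨hX.add_of_right hlow, by rw [natDegree_add_eq_right_of_degree_lt hlow, hXd]⟩

/-- Since `(D + u)ⁱ` is `Dⁱ` plus lower order terms, conjugation keeps the leading coefficient. -/
theorem conj_ne_zero {K : Type*} [Field K] (δ : Der K) (u : K) {L : K[X]} (hL : L ≠ 0) :
    conj δ u L ≠ 0 := by
  intro h
  have h1 := congrArg (fun p => p.coeff L.natDegree) h
  simp only [conj, Polynomial.sum_def, finsetSum_coeff, coeff_C_mul, coeff_zero] at h1
  rw [Finset.sum_eq_single L.natDegree] at h1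
  · obtain ⟨hm, hn⟩ := natDegree_dMul_iterate_one δ u L.natDegree
    have h2 := hm.coeff_natDegree
    rw [hn] at h2
    rw [h2, mul_one] at h1
    exact hL (leadingCoeff_eq_zero.mp h1)
  · intro j hj hjn
    have : j < L.natDegree := lt_of_le_of_ne (le_natDegree_of_mem_supp j hj) hjn
    rw [coeff_eq_zero_of_natDegree_lt (p := (dMul δ u)^[j] 1)
      (by rwa [(natDegree_dMul_iterate_one δ u j).2]), mul_zero]
  · intro hn
    rw [notMem_support_iff.mp hn, zero_mul]

theorem conj_zero_left {K : Type*} [Field K] (δ : Der K) (L : K[X]) :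
    conj δ 0 L = L := by
  have h : ∀ i : ℕ, (dMul δ 0)^[i] 1 = X ^ i := by
    intro i
    induction i with
    | zero => simp
    | succ n ih =>
      rw [Function.iterate_succ_apply', ih, dMul, X_pow_eq_monomial,
        sum_monomial_index _ _ (by simp), X_mul_monomial,
        X_pow_eq_monomial]
      simp
  simp only [conj, h, ← Polynomial.as_sum_support_C_mul_X_pow, Polynomial.sum_def]

/-! ### Operators with constant coefficients -/

/-- For a `k`-linear derivation, products of polynomials thereby act as compositions, so division
and factorization in `k[X]` become available. -/
theorem apply_eq_aeval {k F : Type*} [CommRing k] [CommRing F] [Algebra k F] (d : Der F)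
    (T : Module.End k F) (hT : ⇑T = ⇑d) (L : k[X]) (f : F) : apply d L f = aeval T L f := by
  induction L using Polynomial.induction_on' with
  | add p q hp hq => rw [apply_add, hp, hq, map_add, LinearMap.add_apply]
  | monomial n b =>
    rw [apply_monomial, aeval_monomial, Module.End.mul_apply, Module.algebraMap_end_apply,
      Algebra.smul_def, Module.End.pow_apply, hT]

/-- A derivation vanishing on the constants, as a `k`-linear map. -/
def linearDer {k F : Type*} [CommRing k] [CommRing F] [Algebra k F] (d : Der F)
    (hd : ∀ a : k, d (algebraMap k F a) = 0) : Module.End k F where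
  toFun := d
  map_add' := d.map_add
  map_smul' a x := by
    rw [Algebra.smul_def, Derivation.leibniz, hd, smul_zero, add_zero, RingHom.id_apply,
      smul_eq_mul, Algebra.smul_def]

/-- The remainder of `N` modulo `R` annihilates whatever both annihilate; were it nonzero, its
smaller degree would contradict minimality. -/
theorem IsSymmetricProduct.dvd {k : Type u} [Field k] {P Q R N : k[X]}
    (hR : IsSymmetricProduct (0 : Der k) P Q R) (hN : AnnihilatesProducts (0 : Der k) P Q N) :
    R ∣ N := by
  rw [← EuclideanDomain.mod_eq_zero]
  by_contra hne
  have hmod : AnnihilatesProducts (0 : Der k) P Q (N % R) := by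
    intro F _ _ d hd f g hf hg
    have hd' : ∀ a : k, d (algebraMap k F a) = 0 := fun a => by rw [hd]; simp
    have h1 := hN F d hd f g hf hg
    have h2 := hR.annihilates F d hd f g hf hg
    rw [apply_eq_aeval d (linearDer d hd') rfl] at h1 h2 ⊢
    rw [← EuclideanDomain.mod_add_div N R, map_add, mul_comm R, map_mul (aeval _), LinearMap.add_apply,
      Module.End.mul_apply, h2, map_zero, add_zero] at h1
    exact h1
  have hle := hR.minimal _ hne hmod
  -- A constant `R` has no polynomial of smaller `natDegree` below it, but is a unit.
  by_cases h0 : R.natDegree = 0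
  · exact hne ((EuclideanDomain.mod_eq_zero).2
      ((isUnit_iff_degree_eq_zero.2 (by
        rw [degree_eq_natDegree hR.ne_zero, h0]; rfl)).dvd))
  · exact absurd (natDegree_mod_lt N h0) (not_lt.2 hle)

/-- Index sets larger than the supports allow several products to be summed over one common
antidiagonal. -/
theorem coeff_mul_of_subset {A : Type*} [CommRing A] {x y : HahnSeries ℚ A} {s t : Set ℚ}
    (hs : s.IsPWO) (ht : t.IsPWO) (hx : x.support ⊆ s) (hy : y.support ⊆ t) (r : ℚ) :
    (x * y).coeff r =
      ∑ ij ∈ Finset.antidiagonal hs ht r, x.coeff ij.1 * y.coeff ij.2 := by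
  rw [HahnSeries.coeff_mul]
  refine Finset.sum_subset (fun ij h => ?_) (fun ij h h' => ?_)
  · rw [Finset.mem_antidiagonal] at h ⊢
    exact ⟨hx h.1, hy h.2.1, h.2.2⟩
  · by_contra hne
    refine h' ((Finset.mem_antidiagonal).2 ⟨left_ne_zero_of_mul hne, right_ne_zero_of_mul hne, ?_⟩)
    exact ((Finset.mem_antidiagonal).1 h).2.2

/-! ### Series with coefficients in a differential algebra -/

section Series

variable (k : Type*) {A : Type*} [Field k] [CommRing A] [Algebra k A]

/-- The value of `x d/dx` on the series `∑ aₑ xᵉ` with coefficients in a differential ring `A`,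
namely `∑ (e aₑ + ∂ aₑ) xᵉ`. -/
noncomputable def seriesEuler (D : Der A) (f : HahnSeries ℚ A) : HahnSeries ℚ A where
  coeff e := (e : k) • f.coeff e + D (f.coeff e)
  isPWO_support' := f.isPWO_support.mono fun e he hf => he (by simp [hf])

theorem seriesEuler_mul [CharZero k] (D : Der A) (f g : HahnSeries ℚ A) :
    seriesEuler k D (f * g) = f * seriesEuler k D g + g * seriesEuler k D f := by
  have hs : ∀ h : HahnSeries ℚ A, (seriesEuler k D h).support ⊆ h.support := fun h e he hf =>
    he (by simp [seriesEuler, hf])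
  rw [mul_comm g]
  ext e
  rw [HahnSeries.coeff_add, HahnSeries.coeff_mul_right' g.isPWO_support (hs g),
    HahnSeries.coeff_mul_left' f.isPWO_support (hs f)]
  simp only [seriesEuler]
  rw [HahnSeries.coeff_mul, Finset.smul_sum, map_sum, ← Finset.sum_add_distrib,
    ← Finset.sum_add_distrib]
  refine Finset.sum_congr rfl fun ij hij => ?_
  rw [Finset.mem_antidiagonal] at hij
  rw [← hij.2.2, Rat.cast_add, Derivation.leibniz]
  simp only [smul_eq_mul]
  simp only [Algebra.smul_def, map_add]
  ring

/-- The derivation `d/dx` of the ring of series with coefficients in a differential ring. -/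
noncomputable def seriesDeriv [CharZero k] (D : Der A) : Der (HahnSeries ℚ A) :=
  mkDerivation (fun f => HahnSeries.single (-1 : ℚ) 1 * seriesEuler k D f)
    (fun f g => by
      have : seriesEuler k D (f + g) = seriesEuler k D f + seriesEuler k D g := by
        ext e; simp [seriesEuler]; abel
      rw [this, mul_add])
    (fun f g => by
      rw [seriesEuler_mul]
      ring)

theorem coeff_single_one_mul (f : HahnSeries ℚ A) (c e : ℚ) :
    (HahnSeries.single c 1 * f).coeff e = f.coeff (e - c) := by
  have := HahnSeries.coeff_single_mul_add (r := (1 : A)) (x := f) (a := e - c) (b := c)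
  rwa [sub_add_cancel, one_mul] at this

theorem coeff_seriesDeriv [CharZero k] (D : Der A) (f : HahnSeries ℚ A) (e : ℚ) :
    (seriesDeriv k D f).coeff e =
      ((e + 1 : ℚ) : k) • f.coeff (e + 1) + D (f.coeff (e + 1)) := by
  change (HahnSeries.single (-1 : ℚ) 1 * seriesEuler k D f).coeff e = _
  rw [coeff_single_one_mul, sub_neg_eq_add]
  rfl

variable {k}

/-- With `θ = x d/dx`, one has `xⁱ (d/dx)ⁱ = θ(θ-1)⋯(θ-i+1)`, and `θ` acts on the coefficient of
`xᵉ` as `T + e`. -/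
theorem coeff_iterate_seriesDeriv [CharZero k] (D : Der A) (T : Module.End k A) (hT : ⇑T = ⇑D)
    (i : ℕ) (f : HahnSeries ℚ A) (e : ℚ) :
    ((⇑(seriesDeriv k D))^[i] f).coeff e =
      aeval (T + algebraMap k _ ((e + i : ℚ) : k)) (descPochhammer k i) (f.coeff (e + i)) := by
  induction i generalizing f with
  | zero => simp
  | succ n ih =>
    rw [Function.iterate_succ_apply, ih, coeff_seriesDeriv, descPochhammer_succ_left, mul_comm,
      map_mul, Module.End.mul_apply, aeval_X, aeval_comp, ← hT]
    have he : e + ((n + 1 : ℕ) : ℚ) = e + n + 1 := by push_cast; ring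
    have h1 : aeval (T + algebraMap k (Module.End k A) ((e + n + 1 : ℚ) : k)) (X - 1 : k[X]) =
        T + algebraMap k (Module.End k A) ((e + n : ℚ) : k) := by
      rw [map_sub, aeval_X, map_one, Rat.cast_add _ 1, Rat.cast_one, map_add, map_one]
      abel
    rw [he, h1, LinearMap.add_apply, Module.algebraMap_end_apply, add_comm (T _)]

/-- The coefficientwise embedding of series over `k` into series over a `k`-algebra. -/
noncomputable def seriesMap (k A : Type*) [Field k] [CommRing A] [Algebra k A] :
    HahnSeries ℚ k →+* HahnSeries ℚ A where
  toFun f := f.map (algebraMap k A)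
  map_zero' := by ext; simp
  map_one' := by ext e; by_cases h : e = 0 <;> simp [HahnSeries.coeff_one, h]
  map_add' f g := by ext; simp
  map_mul' f g := HahnSeries.map_mul (algebraMap k A : k →ₙ+* A)

/-- Series over a `k`-algebra form an algebra over the series over `k`. -/
noncomputable abbrev seriesAlgebra (k A : Type*) [Field k] [CommRing A] [Algebra k A] :
    Algebra (HahnSeries ℚ k) (HahnSeries ℚ A) := (seriesMap k A).toAlgebra

attribute [local instance] seriesAlgebra

theorem coeff_algebraMap_series (a : HahnSeries ℚ k) (e : ℚ) :
    (algebraMap (HahnSeries ℚ k) (HahnSeries ℚ A) a).coeff e = algebraMap k A (a.coeff e) := rfl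

theorem seriesDeriv_algebraMap [CharZero k] (D : Der A) (hD : ∀ c : k, D (algebraMap k A c) = 0)
    (a : HahnSeries ℚ k) :
    seriesDeriv k D (algebraMap _ (HahnSeries ℚ A) a) = algebraMap _ _ (hahnDeriv k a) := by
  ext e
  rw [coeff_seriesDeriv, coeff_algebraMap_series, coeff_algebraMap_series, hD, add_zero]
  change _ = algebraMap k A ((HahnSeries.single (-1 : ℚ) 1 * hahnEuler a).coeff e)
  rw [coeff_single_one_mul, sub_neg_eq_add, Algebra.smul_def, ← map_mul]
  rfl

/-- The exponents `e` for which `x^(s+e)` may occur in `N · xˢ`. -/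
def operatorSupport (N : (HahnSeries ℚ k)[X]) : Set ℚ :=
  ⋃ i ∈ N.support, (fun x : ℚ => x - i) '' (N.coeff i).support

theorem isPWO_operatorSupport (N : (HahnSeries ℚ k)[X]) : (operatorSupport N).IsPWO :=
  (Finset.isPWO_bUnion N.support).mpr fun i _ =>
    (N.coeff i).isPWO_support.image_of_monotone fun a b hab => by simpa using hab

theorem mem_operatorSupport {N : (HahnSeries ℚ k)[X]} {i : ℕ} {e : ℚ}
    (h : (N.coeff i).coeff (e + i) ≠ 0) : e ∈ operatorSupport N := by
  simp only [operatorSupport, Set.mem_iUnion]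
  refine ⟨i, mem_support_iff.2 fun h0 => h (by simp [h0]), e + i, h, by simp⟩

theorem mem_operatorSupport_of_indicialCoeff_ne_zero {N : (HahnSeries ℚ k)[X]} {e : ℚ}
    (h : indicialCoeff N e ≠ 0) : e ∈ operatorSupport N := by
  by_contra hcon
  refine h ?_
  rw [indicialCoeff, Polynomial.sum_def]
  refine Finset.sum_eq_zero fun i _ => ?_
  rw [not_not.1 (mt mem_operatorSupport hcon), C_0, zero_mul]

/-- This is the formula for `N · xˢ` with `s` replaced by `T + e` on the coefficient of `xᵉ`. -/
theorem coeff_apply_seriesDeriv [CharZero k] (D : Der A) (T : Module.End k A) (hT : ⇑T = ⇑D)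
    (N : (HahnSeries ℚ k)[X]) (f : HahnSeries ℚ A) {t : Set ℚ} (ht : t.IsPWO)
    (hf : f.support ⊆ t) (r : ℚ) :
    (apply (seriesDeriv k D) N f).coeff r =
      ∑ ij ∈ Finset.antidiagonal (isPWO_operatorSupport N) ht r,
        aeval (T + algebraMap k _ ((ij.2 : ℚ) : k)) (indicialCoeff N ij.1) (f.coeff ij.2) := by
  have hterm : ∀ i : ℕ, (algebraMap _ (HahnSeries ℚ A) (N.coeff i) *
      (⇑(seriesDeriv k D))^[i] f).coeff r =
      ∑ ij ∈ Finset.antidiagonal (isPWO_operatorSupport N) ht r,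
        (N.coeff i).coeff (ij.1 + i) •
          aeval (T + algebraMap k _ ((ij.2 : ℚ) : k)) (descPochhammer k i) (f.coeff ij.2) := by
    intro i
    set a := algebraMap _ (HahnSeries ℚ A) (N.coeff i) with ha
    set g := (⇑(seriesDeriv k D))^[i] f with hg
    have hac : ∀ e, (HahnSeries.single (-(i : ℚ)) 1 * a).coeff e =
        algebraMap k A ((N.coeff i).coeff (e + i)) := fun e => by
      rw [coeff_single_one_mul, sub_neg_eq_add, ha, coeff_algebraMap_series]
    have hgc : ∀ e : ℚ, (HahnSeries.single (i : ℚ) 1 * g).coeff e =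
        aeval (T + algebraMap k _ ((e : ℚ) : k)) (descPochhammer k i) (f.coeff e) := fun e => by
      rw [coeff_single_one_mul, hg, coeff_iterate_seriesDeriv D T hT, sub_add_cancel]
    -- Moving `xⁱ` from one factor to the other puts the supports into sets independent of `i`, so
    -- the sum over `i` can be pulled inside.
    have hmul : a * g = (HahnSeries.single (-(i : ℚ)) 1 * a) *
        (HahnSeries.single (i : ℚ) 1 * g) := by
      rw [mul_mul_mul_comm, HahnSeries.single_mul_single, neg_add_cancel, mul_one,
        HahnSeries.single_zero_one, one_mul]
    rw [hmul, coeff_mul_of_subset (isPWO_operatorSupport N) ht]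
    · exact Finset.sum_congr rfl fun ij _ => by rw [hac, hgc, Algebra.smul_def]
    · intro e he
      rw [HahnSeries.mem_support, hac] at he
      exact mem_operatorSupport fun h => he (by rw [h, map_zero])
    · intro e he
      rw [HahnSeries.mem_support, hgc] at he
      exact hf fun h => he (by rw [h, map_zero])
  rw [apply, Polynomial.sum_def, HahnSeries.coeff_sum, Finset.sum_congr rfl fun i _ => hterm i,
    Finset.sum_comm]
  refine Finset.sum_congr rfl fun ij _ => ?_
  rw [indicialCoeff, Polynomial.sum_def, map_sum, LinearMap.sum_apply]
  refine Finset.sum_congr rfl fun i _ => ?_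
  rw [map_mul, aeval_C, Module.End.mul_apply, Module.algebraMap_end_apply]

theorem exists_isLeast_indicial {N : (HahnSeries ℚ k)[X]} (hN : N ≠ 0) :
    ∃ σ, IsLeast {e | indicialCoeff N e ≠ 0} σ ∧ indicial N = indicialCoeff N σ := by
  have h := indicial_ne_zero N hN
  unfold indicial at h ⊢
  split_ifs at h ⊢ with hex
  · exact ⟨_, hex.choose_spec, rfl⟩
  · exact absurd rfl h

/-- If a series with leading term `h₀` is a solution of `N`, then `h₀` is a solution of the
indicial polynomial of `N`. -/
theorem aeval_indicial_of_apply_eq_zero [CharZero k] (D : Der A) (T : Module.End k A)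
    (hT : ⇑T = ⇑D) {N : (HahnSeries ℚ k)[X]} (hN : N ≠ 0) (h : HahnSeries ℚ A)
    (hpos : ∀ e, h.coeff e ≠ 0 → 0 ≤ e) (hh : apply (seriesDeriv k D) N h = 0) :
    aeval T (indicial N) (h.coeff 0) = 0 := by
  obtain ⟨σ, hσ, hind⟩ := exists_isLeast_indicial hN
  have hc := coeff_apply_seriesDeriv D T hT N h h.isPWO_support subset_rfl σ
  -- Exponents of `N` below `σ` and of `h` below `0` do not contribute, so at total exponent `σ`
  -- only one pair is left.
  rw [hh, HahnSeries.coeff_zero, Finset.sum_eq_single (σ, 0)] at hc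
  · simpa [← hind] using hc.symm
  · rintro ⟨e₁, e₂⟩ hmem hne
    rw [Finset.mem_antidiagonal] at hmem
    have h2 : 0 ≤ e₂ := hpos _ hmem.2.1
    have hsum : e₁ + e₂ = σ := hmem.2.2
    have hlt : e₁ < σ := lt_of_le_of_ne (by linarith) fun heq => hne (by
      rw [Prod.mk.injEq]; exact ⟨heq, by linarith⟩)
    have : indicialCoeff N e₁ = 0 := by
      by_contra h'
      exact absurd (hσ.2 h') (not_le.2 hlt)
    rw [this, map_zero, LinearMap.zero_apply]
  · intro hnot
    have h0 : h.coeff 0 = 0 := by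
      by_contra h'
      exact hnot (Finset.mem_antidiagonal.2
        ⟨mem_operatorSupport_of_indicialCoeff_ne_zero hσ.1, h', add_zero σ⟩)
    rw [h0, map_zero]

/-- Evaluating `p` at `T + c` is evaluating the nonzero polynomial `p(X + c)` at `T`. This makes
each step of the Frobenius recursion solvable, even at exponents differing by an integer, where
logarithms may occur. -/
theorem surjective_aeval_add {T : Module.End k A}
    (hsurj : ∀ p : k[X], p ≠ 0 → Function.Surjective (aeval T p)) (c : k) {p : k[X]}
    (hp : p ≠ 0) : Function.Surjective (aeval (T + algebraMap k _ c) p) := by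
  have h := hsurj (p.comp (X + C c)) (by rwa [Ne, comp_X_add_C_eq_zero_iff])
  rwa [aeval_comp, map_add, aeval_X, aeval_C] at h

/-- Every solution of the indicial polynomial of `N` is the leading term of a series solution
of `N`. -/
theorem exists_series_solution [CharZero k] (D : Der A) (T : Module.End k A)
    (hT : ⇑T = ⇑D) (hsurj : ∀ p : k[X], p ≠ 0 → Function.Surjective (aeval T p))
    {N : (HahnSeries ℚ k)[X]} (hN : N ≠ 0) (a : A) (ha : aeval T (indicial N) a = 0) :
    ∃ f : HahnSeries ℚ A, f.coeff 0 = a ∧ (∀ e, f.coeff e ≠ 0 → 0 ≤ e) ∧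
      apply (seriesDeriv k D) N f = 0 := by
  classical
  obtain ⟨σ, hσ, hind⟩ := exists_isLeast_indicial hN
  -- `S₀` holds the possible exponents of `N` relative to `σ`. The monoid `G` they generate is
  -- partially well-ordered and serves as the support of the solution and as the domain of the
  -- recursion.
  let S₀ : Set ℚ := {e | 0 ≤ e ∧ e + σ ∈ operatorSupport N}
  have hS₀ : S₀.IsPWO := by
    refine ((isPWO_operatorSupport N).image_of_monotone (f := fun e => e - σ)
      fun x y hxy => by simpa using hxy).mono fun e he => ⟨e + σ, he.2, by simp⟩
  let G : AddSubmonoid ℚ := AddSubmonoid.closure S₀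
  have hG : (G : Set ℚ).IsPWO := hS₀.addSubmonoid_closure fun x hx => hx.1
  have hGpos : ∀ e ∈ G, 0 ≤ e := fun e he =>
    AddSubmonoid.closure_induction (fun x hx => hx.1) le_rfl (fun _ _ _ _ => add_nonneg) he
  let Φ : ℚ → k[X] → Module.End k A := fun e p => aeval (T + algebraMap k _ (e : k)) p
  have hlow : ∀ e < σ, indicialCoeff N e = 0 := fun e he => by
    by_contra h'
    exact absurd (hσ.2 h') (not_le.2 he)
  -- When `g` is cut off at exponents `≥ r`, this is minus the contribution of the earlier
  -- coefficients at exponent `σ + r`, which the term from `r` must cancel.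
  let rhs : (ℚ → A) → ℚ → A := fun g r =>
    -∑ ij ∈ Finset.antidiagonal (isPWO_operatorSupport N) hG (σ + r),
      Φ ij.2 (indicialCoeff N ij.1) (g ij.2)
  have hsol : ∀ (r : ℚ) (b : A), ∃ y, Φ r (indicialCoeff N σ) y = b := fun r b =>
    surjective_aeval_add hsurj (r : k) hσ.1 b
  choose sol hsolve using hsol
  have hwf : WellFounded fun x y : G => (x : ℚ) < y := hG.isWF
  obtain ⟨y, hy⟩ : ∃ y : G → A, ∀ r : G, y r = if (r : ℚ) = 0 then a else
      sol r (rhs (fun e => if h : e ∈ G ∧ e < r then y ⟨e, h.1⟩ else 0) r) :=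
    ⟨hwf.fix fun r IH => if (r : ℚ) = 0 then a else
      sol r (rhs (fun e => if h : e ∈ G ∧ e < r then IH ⟨e, h.1⟩ h.2 else 0) r),
      fun r => hwf.fix_eq _ r⟩
  let f : HahnSeries ℚ A :=
    { coeff := fun e => if h : e ∈ G then y ⟨e, h⟩ else 0
      isPWO_support' := hG.mono fun e he => by
        by_contra h
        exact he (dif_neg h) }
  have hfG : f.support ⊆ (G : Set ℚ) := fun e he => by
    by_contra h
    exact he (dif_neg h)
  have hfy : ∀ r : G, f.coeff r = y r := fun r => dif_pos r.2
  have hmain : ∀ r : G, Φ r (indicialCoeff N σ) (f.coeff r) =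
      rhs (fun e => if e < r then f.coeff e else 0) r := by
    intro r
    have hg : (fun e => if h : e ∈ G ∧ e < r then y ⟨e, h.1⟩ else 0) =
        fun e => if e < (r : ℚ) then f.coeff e else 0 := by
      funext e
      by_cases h1 : e ∈ G <;> by_cases h2 : e < (r : ℚ) <;> simp [h1, h2, f]
    rw [hfy, hy, hg]
    split_ifs with h0
    -- At exponent `0` nothing precedes, and the equation is the indicial one satisfied by `a`.
    · have hz : rhs (fun e => if e < (r : ℚ) then f.coeff e else 0) r = 0 := by
        refine neg_eq_zero.2 (Finset.sum_eq_zero fun ij hij => ?_)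
        have := hGpos _ (Finset.mem_antidiagonal.1 hij).2.1
        rw [← h0] at this
        simp only [if_neg (not_lt.2 this), map_zero]
      rw [hz]
      simpa [Φ, h0, ← hind] using ha
    · exact hsolve _ _
  refine ⟨f, ?_, fun e he => hGpos e (hfG he), ?_⟩
  · rw [show (0 : ℚ) = ((0 : G) : ℚ) from rfl, hfy, hy]
    exact if_pos rfl
  ext r
  rw [coeff_apply_seriesDeriv D T hT N f hG hfG r, HahnSeries.coeff_zero]
  by_cases hr : r - σ ∈ G
  · have h1 := hmain ⟨r - σ, hr⟩
    simp only [rhs, add_sub_cancel] at h1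
    -- Coefficients of `f` beyond `r - σ` meet only exponents of `N` below `σ`, hence vanish; the
    -- one at `r - σ` gives the extra term.
    have h2 : ∀ ij ∈ Finset.antidiagonal (isPWO_operatorSupport N) hG r,
        Φ ij.2 (indicialCoeff N ij.1) (f.coeff ij.2) =
          Φ ij.2 (indicialCoeff N ij.1) (if ij.2 < r - σ then f.coeff ij.2 else 0) +
            if ij = (σ, r - σ) then Φ (r - σ) (indicialCoeff N σ) (f.coeff (r - σ)) else 0 := by
      rintro ⟨e₁, e₂⟩ hij
      have hsum : e₁ + e₂ = r := (Finset.mem_antidiagonal.1 hij).2.2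
      rcases lt_trichotomy e₂ (r - σ) with h | h | h
      · rw [if_pos h, if_neg (fun h' => h.ne (Prod.mk.inj h').2), add_zero]
      · obtain rfl : e₁ = σ := by linarith
        subst h
        simp
      · have : e₁ < σ := by linarith
        rw [if_neg (fun h' => h.ne' (Prod.mk.inj h').2), hlow e₁ this]
        simp [Φ]
    rw [Finset.sum_congr rfl h2, Finset.sum_add_distrib, Finset.sum_ite_eq', if_pos, h1,
      add_neg_cancel]
    exact Finset.mem_antidiagonal.2
      ⟨mem_operatorSupport_of_indicialCoeff_ne_zero hσ.1, hr, by simp⟩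
  -- A pair with first exponent `≥ σ` would place `r - σ` in the monoid `G`.
  · refine Finset.sum_eq_zero fun ij hij => ?_
    obtain ⟨hs, hg, hsum⟩ := Finset.mem_antidiagonal.1 hij
    have : ij.1 < σ := by
      by_contra hle
      refine hr ?_
      have h1 : ij.1 - σ ∈ G :=
        AddSubmonoid.subset_closure ⟨sub_nonneg.2 (not_lt.1 hle), by simpa using hs⟩
      have h2 := G.add_mem h1 hg
      rwa [show ij.1 - σ + ij.2 = r - σ by rw [← hsum]; ring] at h2
    rw [hlow _ this, map_zero, LinearMap.zero_apply]

end Series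

theorem der_mul {A : Type*} [CommRing A] (d : Der A) (a b : A) :
    d (a * b) = a * d b + b * d a := d.leibniz a b

theorem der_one {A : Type*} [CommRing A] (d : Der A) : d 1 = 0 := d.map_one_eq_zero

theorem der_pow {A : Type*} [CommRing A] (d : Der A) (a : A) (n : ℕ) :
    d (a ^ n) = n * (a ^ (n - 1) * d a) := by
  rw [d.leibniz_pow, nsmul_eq_mul, smul_eq_mul]

/-! ### Power series with coefficients in a differential algebra -/

section PowerSeries

variable {k F : Type*} [Field k] [CommRing F] [Algebra k F]

/-- The derivation `d/dt` of `F⟦t⟧`. -/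
noncomputable def powerDer (F : Type*) [CommRing F] : Der (PowerSeries F) :=
  mkDerivation (PowerSeries.derivative F) (map_add _) (PowerSeries.derivative F).leibniz

theorem coeff_powerDer (h : PowerSeries F) (n : ℕ) :
    PowerSeries.coeff n (powerDer F h) = PowerSeries.coeff (n + 1) h * (n + 1) :=
  PowerSeries.coeff_derivative h n

theorem powerDer_algebraMap (c : k) : powerDer F (algebraMap k (PowerSeries F) c) = 0 := by
  rw [IsScalarTower.algebraMap_apply k F (PowerSeries F)]
  exact PowerSeries.derivative_C (R := F)

theorem inv_smul_mul_cast [CharZero k] (n : ℕ) (z : F) : (((n : k) + 1)⁻¹ • z) * ((n : F) + 1) = z := by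
  have h : (n : F) + 1 = algebraMap k F ((n : k) + 1) := by simp
  rw [h, mul_comm, ← Algebra.smul_def, smul_inv_smul₀ (Nat.cast_add_one_ne_zero n)]

theorem exists_powerDer_sub_smul_eq [CharZero k] (c : k) (g : PowerSeries F) :
    ∃ f : PowerSeries F, powerDer F f - c • f = g := by
  -- Comparing coefficients gives `(n+1) aₙ₊₁ = gₙ + c aₙ`; the initial value is free and set to
  -- `0`.
  let a : ℕ → F := fun n =>
    Nat.rec 0 (fun n y => ((n : k) + 1)⁻¹ • (PowerSeries.coeff n g + c • y)) n
  refine ⟨PowerSeries.mk a, ?_⟩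
  ext n
  have ha : a (n + 1) = ((n : k) + 1)⁻¹ • (PowerSeries.coeff n g + c • a n) := rfl
  rw [map_sub, coeff_powerDer, PowerSeries.coeff_mk, ha, inv_smul_mul_cast]
  simp

/-- Over an algebraically closed field `p` splits, so the operator is a composition of first order
operators `d/dt - c`, each surjective, and a nonzero scalar. -/
theorem surjective_aeval_powerDer [CharZero k] [IsAlgClosed k] {p : k[X]} (hp : p ≠ 0) :
    Function.Surjective
      (aeval (linearDer (k := k) (powerDer F) powerDer_algebraMap) p) := by
  set T := linearDer (k := k) (powerDer F) powerDer_algebraMap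
  rw [(IsAlgClosed.splits p).eq_prod_roots, map_mul, aeval_C]
  have hprod : ∀ s : Multiset k,
      Function.Surjective (aeval T (s.map fun a => X - C a).prod) := by
    intro s
    induction s using Multiset.induction_on with
    | empty =>
      intro g
      exact ⟨g, by simp⟩
    | cons a s ih =>
      rw [Multiset.map_cons, Multiset.prod_cons, map_mul]
      refine Function.Surjective.comp (g := aeval T (X - C a)) (fun g => ?_) ih
      obtain ⟨f, hf⟩ := exists_powerDer_sub_smul_eq a g
      refine ⟨f, ?_⟩
      rw [map_sub, aeval_X, aeval_C, LinearMap.sub_apply, Module.algebraMap_end_apply]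
      exact hf
  refine Function.Surjective.comp (g := algebraMap k (Module.End k (PowerSeries F)) p.leadingCoeff)
    (fun g => ⟨p.leadingCoeff⁻¹ • g, ?_⟩) (hprod _)
  rw [Module.algebraMap_end_apply, smul_inv_smul₀ (leadingCoeff_ne_zero.2 hp)]

/-- The Taylor series `∑ d^n(f) t^n / n!` of an element of a differential algebra. -/
noncomputable def taylorSeries (k : Type*) [Field k] [Algebra k F] (d : Der F) (f : F) :
    PowerSeries F :=
  PowerSeries.mk fun n => (n.factorial : k)⁻¹ • (⇑d)^[n] f

theorem constantCoeff_taylorSeries (d : Der F) (f : F) :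
    PowerSeries.coeff 0 (taylorSeries k d f) = f := by
  simp [taylorSeries]

theorem map_inv_smul_of_constants {d : Der F} (hd : ∀ a : k, d (algebraMap k F a) = 0) (c : k)
    (z : F) : d (c • z) = c • d z :=
  (linearDer d hd).map_smul c z

/-- The hypothesis reads `(n+1) hₙ₊₁ = d hₙ`, so the constant term determines `h`. Identities
between Taylor series thus reduce to their constant terms. -/
theorem eq_taylorSeries [CharZero k] {d : Der F} (hd : ∀ a : k, d (algebraMap k F a) = 0) {h : PowerSeries F}
    (hh : ∀ n, PowerSeries.coeff n (powerDer F h) = d (PowerSeries.coeff n h)) :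
    h = taylorSeries k d (PowerSeries.coeff 0 h) := by
  ext n
  induction n with
  | zero => rw [constantCoeff_taylorSeries]
  | succ n ih =>
    have h1 := hh n
    rw [coeff_powerDer, ih, taylorSeries, PowerSeries.coeff_mk, map_inv_smul_of_constants hd,
      ← Function.iterate_succ_apply' d] at h1
    rw [taylorSeries, PowerSeries.coeff_mk, Nat.factorial_succ, Nat.cast_mul, mul_inv, mul_smul,
      ← h1, Nat.cast_succ, Algebra.smul_def, mul_left_comm, ← Algebra.smul_def]
    have h2 := inv_smul_mul_cast (k := k) n (1 : F)
    rw [smul_mul_assoc, one_mul] at h2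
    rw [h2, mul_one]

theorem coeff_powerDer_taylorSeries [CharZero k] (d : Der F) (f : F) (n : ℕ) :
    PowerSeries.coeff n (powerDer F (taylorSeries k d f)) =
      PowerSeries.coeff n (taylorSeries k d (d f)) := by
  rw [coeff_powerDer, taylorSeries, taylorSeries, PowerSeries.coeff_mk, PowerSeries.coeff_mk,
    Nat.factorial_succ, Nat.cast_mul, mul_inv, mul_smul, Nat.cast_succ, inv_smul_mul_cast,
    Function.iterate_succ_apply]

theorem coeff_taylorSeries_apply {d : Der F} (hd : ∀ a : k, d (algebraMap k F a) = 0) (f : F)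
    (n : ℕ) : PowerSeries.coeff n (taylorSeries k d (d f)) =
      d (PowerSeries.coeff n (taylorSeries k d f)) := by
  rw [taylorSeries, taylorSeries, PowerSeries.coeff_mk, PowerSeries.coeff_mk,
    map_inv_smul_of_constants hd, ← Function.iterate_succ_apply, Function.iterate_succ_apply']

/-- The Taylor series as a homomorphism from a differential algebra `(F, d)` to
`(F⟦t⟧, d/dt)`. -/
noncomputable def taylorHom [CharZero k] (d : Der F) (hd : ∀ a : k, d (algebraMap k F a) = 0) :
    F →+* PowerSeries F where
  toFun := taylorSeries k d
  map_one' := by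
    have h := eq_taylorSeries hd (h := 1) (fun n => by
      rw [der_one, map_zero, PowerSeries.coeff_one]
      split_ifs <;> simp)
    rw [PowerSeries.coeff_zero_one] at h
    exact h.symm
  map_zero' := by
    ext n
    change PowerSeries.coeff n (PowerSeries.mk _) = _
    rw [PowerSeries.coeff_mk, iterate_map_zero, smul_zero, map_zero]
  map_add' f g := by
    ext n
    rw [map_add, taylorSeries, taylorSeries, taylorSeries, PowerSeries.coeff_mk,
      PowerSeries.coeff_mk, PowerSeries.coeff_mk, iterate_map_add, smul_add]
  map_mul' f g := by
    -- Both `d/dt` and the coefficientwise `d` obey the product rule, so they still agree on the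
    -- product.
    have h := eq_taylorSeries hd (h := taylorSeries k d f * taylorSeries k d g) (fun n => by
      rw [der_mul, map_add, PowerSeries.coeff_mul,
        mul_comm (taylorSeries k d g), PowerSeries.coeff_mul, PowerSeries.coeff_mul, map_sum,
        ← Finset.sum_add_distrib]
      refine Finset.sum_congr rfl fun ij _ => ?_
      rw [coeff_powerDer_taylorSeries, coeff_powerDer_taylorSeries,
        coeff_taylorSeries_apply hd, coeff_taylorSeries_apply hd, der_mul, mul_comm (d _)])
    rw [PowerSeries.coeff_zero_eq_constantCoeff_apply, map_mul,
      ← PowerSeries.coeff_zero_eq_constantCoeff_apply,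
      ← PowerSeries.coeff_zero_eq_constantCoeff_apply, constantCoeff_taylorSeries,
      constantCoeff_taylorSeries] at h
    exact h.symm

theorem taylorHom_apply [CharZero k] (d : Der F) (hd : ∀ a : k, d (algebraMap k F a) = 0) (L : k[X]) (f : F) :
    taylorHom d hd (apply d L f) = apply (powerDer F) L (taylorHom d hd f) := by
  rw [map_apply_of_commute (RingHom.id k) (taylorHom d hd) (fun a => ?_) d (powerDer F)
    (fun x => ?_) L f, Polynomial.map_id]
  · have h := eq_taylorSeries hd (h := algebraMap k (PowerSeries F) a) (fun n => by
      rw [powerDer_algebraMap, map_zero, IsScalarTower.algebraMap_apply k F (PowerSeries F)]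
      change 0 = d (PowerSeries.coeff n (PowerSeries.C _))
      rw [PowerSeries.coeff_C]
      split_ifs <;> simp [hd])
    rw [RingHom.id_apply, h, IsScalarTower.algebraMap_apply k F (PowerSeries F)]
    change taylorSeries k d _ = taylorSeries k d (PowerSeries.coeff 0 (PowerSeries.C _))
    rw [PowerSeries.coeff_zero_C]
  · ext n
    exact (coeff_powerDer_taylorSeries d x n).symm

end PowerSeries

/-! ### Products of series solutions -/

attribute [local instance] seriesAlgebra

theorem coeff_zero_mul_of_nonneg {A : Type*} [CommRing A] {f g : HahnSeries ℚ A}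
    (hf : ∀ e, f.coeff e ≠ 0 → 0 ≤ e) (hg : ∀ e, g.coeff e ≠ 0 → 0 ≤ e) :
    (f * g).coeff 0 = f.coeff 0 * g.coeff 0 := by
  rw [HahnSeries.coeff_mul]
  refine Finset.sum_eq_single (0, 0) (fun ij hij hne => ?_) (fun h => ?_)
  · obtain ⟨h1, h2, h3⟩ := Finset.mem_antidiagonal.1 hij
    have h1' := hf _ h1
    have h2' := hg _ h2
    exact absurd (Prod.ext (by simp; linarith) (by simp; linarith)) hne
  · by_contra hne
    exact h (Finset.mem_antidiagonal.2
      ⟨left_ne_zero_of_mul hne, right_ne_zero_of_mul hne, add_zero 0⟩)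

theorem nonneg_of_coeff_mul_ne_zero {A : Type*} [CommRing A] {f g : HahnSeries ℚ A}
    (hf : ∀ e, f.coeff e ≠ 0 → 0 ≤ e) (hg : ∀ e, g.coeff e ≠ 0 → 0 ≤ e) (e : ℚ)
    (he : (f * g).coeff e ≠ 0) : 0 ≤ e := by
  rw [HahnSeries.coeff_mul] at he
  obtain ⟨ij, hij, -⟩ := Finset.exists_ne_zero_of_sum_ne_zero he
  obtain ⟨h1, h2, h3⟩ := Finset.mem_antidiagonal.1 hij
  rw [← h3]
  exact add_nonneg (hf _ h1) (hg _ h2)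

/-- Inhomogeneous equations may be unsolvable in `F`, so the Frobenius recursion is run over `F⟦t⟧`.
-/
theorem AnnihilatesProducts.indicial {k : Type u} [Field k] [IsAlgClosed k] [CharZero k]
    {L Q M : (HahnSeries ℚ k)[X]} (hL : L ≠ 0) (hQ : Q ≠ 0) (hM : M ≠ 0)
    (h : AnnihilatesProducts (hahnDeriv k) L Q M) :
    AnnihilatesProducts (0 : Der k) (indicial L) (indicial Q) (indicial M) := by
  intro F _ _ d hd f g hf hg
  have hd' : ∀ a : k, d (algebraMap k F a) = 0 := fun a => by rw [hd]; simp
  let T := linearDer (k := k) (powerDer F) powerDer_algebraMap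
  have key : ∀ (N : (HahnSeries ℚ k)[X]) (z : F), N ≠ 0 → apply d (DiffOp.indicial N) z = 0 →
      ∃ f : HahnSeries ℚ (PowerSeries F), f.coeff 0 = taylorHom d hd' z ∧
        (∀ e, f.coeff e ≠ 0 → 0 ≤ e) ∧ apply (seriesDeriv k (powerDer F)) N f = 0 := by
    intro N z hN hz
    refine exists_series_solution (powerDer F) T rfl
      (fun p hp => surjective_aeval_powerDer hp) hN _ ?_
    rw [← apply_eq_aeval (powerDer F) T rfl, ← taylorHom_apply, hz, map_zero]
  obtain ⟨f', hf0, hfpos, hf'⟩ := key L f hL hf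
  obtain ⟨g', hg0, hgpos, hg'⟩ := key Q g hQ hg
  have h1 := h (HahnSeries ℚ (PowerSeries F)) (seriesDeriv k (powerDer F))
    (seriesDeriv_algebraMap (powerDer F) powerDer_algebraMap) f' g' hf' hg'
  have h2 := aeval_indicial_of_apply_eq_zero (powerDer F) T rfl hM (f' * g')
    (nonneg_of_coeff_mul_ne_zero hfpos hgpos) h1
  rw [coeff_zero_mul_of_nonneg hfpos hgpos, hf0, hg0, ← map_mul,
    ← apply_eq_aeval (powerDer F) T rfl, ← taylorHom_apply] at h2
  -- The constant term of a Taylor series recovers the element, so vanishing descends to `F`.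
  have h3 := constantCoeff_taylorSeries (k := k) d (apply d (DiffOp.indicial M) (f * g))
  change PowerSeries.coeff 0 (taylorHom d hd' _) = _ at h3
  rw [← h3, h2, map_zero]

/-! ### Expansion of rational functions -/

theorem coeff_hahnDeriv {k : Type*} [Field k] [CharZero k] (f : HahnSeries ℚ k) (e : ℚ) :
    (hahnDeriv k f).coeff e = ((e + 1 : ℚ) : k) * f.coeff (e + 1) := by
  change (HahnSeries.single (-1 : ℚ) 1 * hahnEuler f).coeff e = _
  rw [coeff_single_one_mul, sub_neg_eq_add]
  rfl

theorem hahnDeriv_eval₂ {k : Type*} [Field k] [CharZero k] (p : k[X]) :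
    hahnDeriv k (eval₂ HahnSeries.C (HahnSeries.single (1 : ℚ) 1) p) =
      eval₂ HahnSeries.C (HahnSeries.single (1 : ℚ) 1) (derivative p) := by
  have hC : ∀ a : k, hahnDeriv k (HahnSeries.C a) = 0 := fun a => by
    ext e
    rw [coeff_hahnDeriv, HahnSeries.C_apply, HahnSeries.coeff_single, HahnSeries.coeff_zero]
    split_ifs with h <;> simp [h]
  have hX : hahnDeriv k (HahnSeries.single (1 : ℚ) 1) = 1 := by
    ext e
    rw [coeff_hahnDeriv, HahnSeries.coeff_single, HahnSeries.coeff_one]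
    by_cases h : e = 0 <;> simp [h]
  induction p using Polynomial.induction_on' with
  | add p q hp hq => rw [eval₂_add, map_add, hp, hq, derivative_add, eval₂_add]
  | monomial n a =>
    rw [eval₂_monomial, derivative_monomial, eval₂_monomial, der_mul, hC, mul_zero,
      add_zero, der_pow, hX, map_mul, map_natCast]
    ring

/-- The claim holds on polynomials; applying the product rule to `a * denom = num` and cancelling
the denominator extends it to `a`. -/
theorem hahnDeriv_ratToHahn {k : Type*} [Field k] [CharZero k] (a : RatFunc k) :
    hahnDeriv k (ratToHahn k a) = ratToHahn k (ratDeriv k a) := by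
  have hι : ∀ p : k[X], ratToHahn k (algebraMap k[X] (RatFunc k) p) =
      eval₂ HahnSeries.C (HahnSeries.single (1 : ℚ) 1) p := fun p =>
    IsFractionRing.lift_algebraMap (eval₂_hahn_injective k) p
  have hder : ∀ p : k[X], ratDeriv k (algebraMap k[X] (RatFunc k) p) =
      algebraMap k[X] (RatFunc k) (derivative p) := fun p => by
    have := ratDerivFun_div p 1 one_ne_zero
    change ratDerivFun _ = _
    simpa using this
  have hpoly : ∀ p : k[X], hahnDeriv k (ratToHahn k (algebraMap k[X] (RatFunc k) p)) =
      ratToHahn k (ratDeriv k (algebraMap k[X] (RatFunc k) p)) := fun p => by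
    rw [hder, hι, hι, hahnDeriv_eval₂]
  have hb : algebraMap k[X] (RatFunc k) a.denom ≠ 0 :=
    (map_ne_zero_iff _ (IsFractionRing.injective k[X] (RatFunc k))).2 a.denom_ne_zero
  have hab : a * algebraMap k[X] (RatFunc k) a.denom = algebraMap k[X] (RatFunc k) a.num := by
    rw [← div_eq_iff hb |>.1 (RatFunc.num_div_denom a)]
  have h1 := hpoly a.num
  rw [← hab, map_mul, der_mul, der_mul, hpoly, map_add, map_mul, map_mul, add_right_inj] at h1
  exact mul_left_cancel₀ ((map_ne_zero (ratToHahn k)).2 hb) h1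

theorem ratToHahn_map_ne_zero {k : Type*} [Field k] {L : (RatFunc k)[X]} (hL : L ≠ 0) :
    L.map (ratToHahn k) ≠ 0 :=
  (Polynomial.map_ne_zero_iff (ratToHahn k).injective).2 hL

theorem dvd_genInd₀ {k : Type u} [Field k] [IsAlgClosed k] [CharZero k] {L Q : (RatFunc k)[X]}
    (hL : L ≠ 0) (hQ : Q ≠ 0) (v : ℕ) (p q : k[X]) {M : (RatFunc k)[X]} {R : k[X]}
    (hM : IsSymmetricProduct (ratDeriv k) L Q M)
    (hR : IsSymmetricProduct (0 : Der k) (genInd₀ v p L) (genInd₀ v q Q) R) :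
    R ∣ genInd₀ v (p + q) M := by
  refine hR.dvd ?_
  have hexp : expPart (p + q) v = expPart p v + expPart q v :=
    Polynomial.sum_add_index p q _ (by simp) (by simp)
  rw [show genInd₀ v (p + q) M = indicial (conj (hahnDeriv k) (hahnDeriv k (expPart p v) +
    hahnDeriv k (expPart q v)) (M.map (ratToHahn k))) by rw [genInd₀, hexp, map_add]]
  exact ((hM.annihilates.map (ratToHahn k) hahnDeriv_ratToHahn).conj _ _).indicial
    (conj_ne_zero _ _ (ratToHahn_map_ne_zero hL)) (conj_ne_zero _ _ (ratToHahn_map_ne_zero hQ))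
    (conj_ne_zero _ _ (ratToHahn_map_ne_zero hM.ne_zero))

theorem genInd₀_zero {k : Type*} [Field k] [CharZero k] (v : ℕ) (L : (RatFunc k)[X]) :
    genInd₀ v 0 L = ind₀ L := by
  rw [genInd₀, expPart, Polynomial.sum_zero_index, map_zero, conj_zero_left, ind₀]

end DiffOp

theorem mainTheorem8 {k : Type*} [Field k] [IsAlgClosed k] [CharZero k]
    (L Q : (RatFunc k)[X]) (hL : L ≠ 0) (hQ : Q ≠ 0) :
    (∀ v : ℕ, 0 < v → ∀ p q : k[X], ∀ (M : (RatFunc k)[X]) (R : k[X]),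
      DiffOp.IsSymmetricProduct (DiffOp.ratDeriv k) L Q M →
      DiffOp.IsSymmetricProduct (0 : DiffOp.Der k)
        (DiffOp.genInd₀ v p L) (DiffOp.genInd₀ v q Q) R →
      R ∣ DiffOp.genInd₀ v (p + q) M) ∧
    (∀ (M : (RatFunc k)[X]) (R : k[X]),
      DiffOp.IsSymmetricProduct (DiffOp.ratDeriv k) L Q M →
      DiffOp.IsSymmetricProduct (0 : DiffOp.Der k) (DiffOp.ind₀ L) (DiffOp.ind₀ Q) R →
      R ∣ DiffOp.ind₀ M) := by
  refine ⟨fun v _ p q M R hM hR => DiffOp.dvd_genInd₀ hL hQ v p q hM hR, fun M R hM hR => ?_⟩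
  -- With zero exponential parts the ramification `v` is immaterial; `1` is an arbitrary choice.
  have h := DiffOp.dvd_genInd₀ hL hQ 1 0 0 (R := R) hM
  rw [add_zero, DiffOp.genInd₀_zero, DiffOp.genInd₀_zero, DiffOp.genInd₀_zero] at h
  exact h hR
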